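/- Let $\rho\in(-1,1)$, $\Sigma=\begin{pmatrix}1&\rho\\ \rho&1\end{pmatrix}$, and let $X=(X_1,X_2)$ and $Y=(Y_1,Y_2)$ be independent random vectors, each with the centred Gaussian law $\mathrm N(0,\Sigma)$. Put $Z_1=X_1/Y_1$ and $Z_2=X_2/Y_2$. For $n\in\{0,1,2,\dots\}$ and $(z_1,z_2)\in\mathbb R^2$ let $$f^{(n)}(z_1,z_2)=\frac{2^{2n}}{\binom{2n}{n}}\,\frac1{\pi^2}\,\frac{(1+z_1z_2)^{2n}}{(1+z_1^2)^{n+1}(1+z_2^2)^{n+1}} .$$ (i) The pair $(Z_1,Z_2)$ has a joint density with respect to Lebesgue measure on $\mathbb R^2$, namely $$f^{\rho}(z_1,z_2)=(1-\rho^2)\sum_{n=0}^\infty \rho^{2n} f^{(n)}(z_1,z_2),$$ where the series converges for every $(z_1,z_2)\in\mathbb R^2$ and the weights $(1-\rho^2)\rho^{2n}$, $n\ge0$, sum to $1$ (with the convention $0^0=1$). (ii) For every $n\ge 0$, $f^{(n)}$ is a probability density on $\mathbb R^2$: it is nonnegative, and integrable with integral $1$. If $(C_1,C_2)$ is a random vector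 with density $f^{(n)}$, then $C_1$ and $C_2$ each have the standard Cauchy distribution, with density $\frac{1}{\pi(1+z^2)}$, and for all $w_1,w_2\ge 0$ with $w_1+w_2=1$ the variable $w_1C_1+w_2C_2$ has the standard Cauchy distribution as well. -/

import Mathlib

open MeasureTheory ProbabilityTheory

/-- The `2 × 2` correlation matrix with off-diagonal entry `ρ`. -/
def corrMatrix (ρ : ℝ) : Matrix (Fin 2) (Fin 2) ℝ := !![1, ρ; ρ, 1]

/-- The `n`-th mixture component
`f⁽ⁿ⁾(z₁, z₂) = 2²ⁿ / C(2n, n) · 1 / π² · (1 + z₁ z₂)²ⁿ / ((1 + z₁²)ⁿ⁺¹ (1 + z₂²)ⁿ⁺¹)`. -/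
noncomputable def mixComponent (n : ℕ) (z : ℝ × ℝ) : ℝ :=
  (2 : ℝ) ^ (2 * n) / (Nat.choose (2 * n) n : ℝ) * (1 / Real.pi ^ 2) *
    ((1 + z.1 * z.2) ^ (2 * n) / ((1 + z.1 ^ 2) ^ (n + 1) * (1 + z.2 ^ 2) ^ (n + 1)))

/-- The Borel measure on `ℝ²` with density `f` with respect to Lebesgue measure. -/
noncomputable def densityMeasure (f : ℝ × ℝ → ℝ) : Measure (ℝ × ℝ) :=
  (volume : Measure (ℝ × ℝ)).withDensity (fun z => ENNReal.ofReal (f z))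

/-! The Cauchy statements rest on the identity `2 (1 + z₁ z₂) = (1 + i z₁)(1 - i z₂) + (1 - i z₁)(1
+ i z₂)`. Expanding its `2n`-th power splits `mixComponent n` into products of one-variable
functions `moebiusFactor n j z₁ * moebiusFactor n (2n - j) z₂`. For `j > n` the factor of index `j`
has its only pole at `-i`, so its Fourier integral vanishes at every frequency `a ≥ 0`. If `j ≠ n`,
one of `j`, `2n - j` exceeds `n`; hence only `j = n` survives, and the transform at `(a, b)` with
`a, b ≥ 0` is `exp (-(a + b))` (`integral_cexp_mul_mixComponent`). Total mass and convex
combinations follow from this.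

For the mixture, substituting `x = y z` coordinatewise gives the ratio density `∫ |y₁ y₂| p(y) p(y
z) dy` (`map_ratio_prod_densityMeasure`). For Gaussian `p` the integrand is a Gaussian times `exp (c
y₁ y₂)`; symmetrizing in `y₁` turns this into `cosh (c y₁ y₂)`, whose power series integrates
termwise to odd absolute Gaussian moments (`lintegral_gaussianDensity_ratio`). -/

/-! ### One-variable Fourier integrals. -/

lemma integrableOn_pow_mul_cexp_neg_mul {w : ℂ} (hw : 0 < w.re) (n : ℕ) :
    IntegrableOn (fun x : ℝ => (x : ℂ) ^ n * Complex.exp (-w * x)) (Set.Ioi 0) := by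
  have h := integrableOn_rpow_mul_exp_neg_mul_rpow (p := 1) (s := n) (b := w.re)
    (by have : (0 : ℝ) ≤ n := n.cast_nonneg
        linarith) one_pos hw
  refine Integrable.mono' h (by fun_prop) ?_
  filter_upwards [self_mem_ae_restrict measurableSet_Ioi] with x hx
  have hx : 0 < x := hx
  simp [Complex.norm_exp, abs_of_pos hx]

lemma integral_pow_mul_cexp_neg_mul_Ioi {w : ℂ} (hw : 0 < w.re) (n : ℕ) :
    ∫ x : ℝ in Set.Ioi 0, (x : ℂ) ^ n * Complex.exp (-w * x) = n.factorial / w ^ (n + 1) := by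
  have hw0 : w ≠ 0 := fun h => by simp [h] at hw
  induction n with
  | zero =>
    have := integral_exp_mul_complex_Ioi (a := -w) (by simpa using hw) 0
    simpa [neg_div_neg_eq] using this
  | succ n ih =>
    -- Integration by parts: `x ^ (n + 1) * exp (-w x)` vanishes at both ends, so `w` times the
    -- integral of index `n + 1` is `n + 1` times the one of index `n`.
    have hderiv : ∀ x ∈ Set.Ici (0 : ℝ),
        HasDerivAt (fun x : ℝ => (x : ℂ) ^ (n + 1) * Complex.exp (-w * x))
          ((n + 1) * ((x : ℂ) ^ n * Complex.exp (-w * x))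
            - w * ((x : ℂ) ^ (n + 1) * Complex.exp (-w * x))) x := by
      intro x _
      have h1 : HasDerivAt (fun z : ℂ => z ^ (n + 1) * Complex.exp (-w * z))
          ((n + 1) * ((x : ℂ) ^ n * Complex.exp (-w * x))
            - w * ((x : ℂ) ^ (n + 1) * Complex.exp (-w * x))) (x : ℂ) := by
        convert! (hasDerivAt_pow (n + 1) (x : ℂ)).mul
          (((hasDerivAt_id (x : ℂ)).const_mul (-w)).cexp) using 1
        simp
        ring
      exact h1.comp_ofReal
    have hI := (((integrableOn_pow_mul_cexp_neg_mul hw n).const_mul ((n : ℂ) + 1)).sub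
      ((integrableOn_pow_mul_cexp_neg_mul hw (n + 1)).const_mul w))
    have ht : Filter.Tendsto (fun x : ℝ => (x : ℂ) ^ (n + 1) * Complex.exp (-w * x))
        Filter.atTop (nhds 0) := by
      rw [tendsto_zero_iff_norm_tendsto_zero]
      have h := tendsto_rpow_mul_exp_neg_mul_atTop_nhds_zero ((n + 1 : ℕ) : ℝ) w.re hw
      refine h.congr' ?_
      filter_upwards [Filter.eventually_gt_atTop 0] with x hx
      rw [Real.rpow_natCast]
      simp [Complex.norm_exp, abs_of_pos hx]
    have key := integral_Ioi_of_hasDerivAt_of_tendsto' hderiv hI ht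
    rw [integral_sub ((integrableOn_pow_mul_cexp_neg_mul hw n).const_mul _)
      ((integrableOn_pow_mul_cexp_neg_mul hw (n + 1)).const_mul _), integral_const_mul,
      integral_const_mul, ih] at key
    simp only [Complex.ofReal_zero, ne_eq, Nat.add_eq_zero_iff, one_ne_zero, and_false,
      not_false_eq_true, zero_pow, zero_mul, sub_zero] at key
    rw [sub_eq_zero] at key
    rw [eq_div_iff (pow_ne_zero _ hw0), Nat.factorial_succ, pow_succ w (n + 1), ← mul_assoc,
      mul_right_comm, mul_comm _ w, ← key]
    field_simp
    push_cast
    ring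

lemma one_sub_I_mul_ne_zero (z : ℝ) : (1 - Complex.I * z : ℂ) ≠ 0 := by
  intro h
  simpa using congrArg Complex.re h

lemma one_add_I_mul_ne_zero (z : ℝ) : (1 + Complex.I * z : ℂ) ≠ 0 := by
  intro h
  simpa using congrArg Complex.re h

lemma norm_sq_one_sub_I_mul (z : ℝ) : ‖(1 - Complex.I * z : ℂ)‖ ^ 2 = 1 + z ^ 2 := by
  rw [← Complex.normSq_eq_norm_sq, Complex.normSq_apply]
  simp
  ring

lemma norm_one_add_I_mul (z : ℝ) : ‖(1 + Complex.I * z : ℂ)‖ = ‖(1 - Complex.I * z : ℂ)‖ := by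
  rw [← Complex.norm_conj]
  simp [sub_eq_add_neg]

lemma one_le_norm_one_sub_I_mul (z : ℝ) : 1 ≤ ‖(1 - Complex.I * z : ℂ)‖ := by
  have h := norm_sq_one_sub_I_mul z
  nlinarith [norm_nonneg (1 - Complex.I * z : ℂ), sq_nonneg z]

lemma norm_cexp_I_mul (a z : ℝ) : ‖Complex.exp (Complex.I * (a * z))‖ = 1 := by
  rw [mul_comm, ← Complex.ofReal_mul, Complex.norm_exp_ofReal_mul_I]

/-- Fourier inversion, in the normalisation `∫ exp (i x y) f x dx`. -/
lemma integral_cexp_mul_of_fourier_eq {F : ℝ → ℂ} {f : ℝ → ℂ} (hF : Integrable F)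
    (hc : Continuous F) (hf : Integrable f)
    (h : ∀ z : ℝ, ∫ x : ℝ, Complex.exp (Complex.I * (z * x)) * F x = f z) (a : ℝ) :
    ∫ z : ℝ, Complex.exp (Complex.I * (a * z)) * f z = 2 * Real.pi * F (-a) := by
  have hpi := Real.pi_pos
  -- The kernel of `fourier` is `exp (-2πi x w)`, hence `z = -2π w`; rescaling back produces the
  -- factor `2π`.
  have hcF : FourierTransform.fourier F = fun w => f (-(2 * Real.pi) * w) := by
    ext w
    rw [Real.fourier_eq', ← h]
    congr 1
    ext x
    simp only [smul_eq_mul, RCLike.inner_apply, conj_trivial]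
    congr 2
    push_cast
    ring
  have hI : Integrable (FourierTransform.fourier F) := by
    rw [hcF]
    exact hf.comp_mul_left' (by linarith)
  have inv := congrFun (hc.fourierInv_fourier_eq hF hI) (-a)
  rw [Real.fourierInv_eq', hcF] at inv
  have hs := Measure.integral_comp_mul_left
    (fun z : ℝ => Complex.exp (Complex.I * (a * z)) * f z) (-(2 * Real.pi))
  rw [← inv]
  have h2 : ∫ v : ℝ, Complex.exp (↑(2 * Real.pi * inner ℝ v (-a)) * Complex.I) •
      f (-(2 * Real.pi) * v) = ∫ x : ℝ, Complex.exp (Complex.I * (a * ↑(-(2 * Real.pi) * x))) *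
        f (-(2 * Real.pi) * x) := by
    congr 1
    ext x
    simp only [smul_eq_mul, RCLike.inner_apply, conj_trivial]
    congr 2
    push_cast
    ring
  rw [h2, hs, abs_inv, abs_neg, abs_of_pos (by positivity), Complex.real_smul]
  push_cast
  field_simp

lemma integrable_of_norm_le_inv_one_add_sq {f : ℝ → ℂ} (hm : AEStronglyMeasurable f)
    (h : ∀ z, ‖f z‖ ≤ (1 + z ^ 2)⁻¹) : Integrable f :=
  integrable_inv_one_add_sq.mono' hm (Filter.Eventually.of_forall h)

/-- The Möbius moments `(1 + i z)ʲ / (1 - i z)ʲ⁺ᵐ` with `m ≥ 2` are dominated by `1 / (1 + z²)`. -/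
lemma norm_moebius_le (j m : ℕ) (z : ℝ) :
    ‖(1 + Complex.I * z : ℂ) ^ j / (1 - Complex.I * z) ^ (j + m + 2)‖ ≤ (1 + z ^ 2)⁻¹ := by
  have h1 := one_le_norm_one_sub_I_mul z
  have hpos : 0 < ‖(1 - Complex.I * z : ℂ)‖ := by linarith
  rw [norm_div, norm_pow, norm_pow, norm_one_add_I_mul, ← norm_sq_one_sub_I_mul,
    show j + m + 2 = j + (m + 2) by ring, pow_add, div_mul_eq_div_div,
    div_self (pow_pos hpos _).ne', one_div]
  exact inv_anti₀ (by positivity) (pow_le_pow_right₀ h1 (by omega))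

lemma integrable_cexp_mul_moebius (a : ℝ) (j m : ℕ) :
    Integrable fun z : ℝ => Complex.exp (Complex.I * (a * z)) *
      ((1 + Complex.I * z : ℂ) ^ j / (1 - Complex.I * z) ^ (j + m + 2)) := by
  refine integrable_of_norm_le_inv_one_add_sq (by fun_prop) fun z => ?_
  rw [norm_mul, norm_cexp_I_mul, one_mul]
  exact norm_moebius_le j m z

/-- Up to `(m + 1)!`, the power of `1 - i z` is the transform of `x₊ ^ (m + 1) * exp (-x)`.
Inversion evaluates this function at `-a ≤ 0`, where it is zero. The exponent `m + 2 ≥ 2` gives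
continuity at the origin and an integrable transform. -/
lemma integral_cexp_div_one_sub_I_mul_pow {a : ℝ} (ha : 0 ≤ a) (m : ℕ) :
    ∫ z : ℝ, Complex.exp (Complex.I * (a * z)) * (1 / (1 - Complex.I * z) ^ (m + 2)) = 0 := by
  set F : ℝ → ℂ := fun x => ((max x 0 : ℝ) : ℂ) ^ (m + 1) * Complex.exp (-x) with hFdef
  have hF0 : ∀ x : ℝ, x ≤ 0 → F x = 0 := fun x hx => by simp [hFdef, max_eq_right hx]
  have hFpos : ∀ x ∈ Set.Ioi (0 : ℝ), F x = (x : ℂ) ^ (m + 1) * Complex.exp (-1 * x) := by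
    intro x hx
    simp only [hFdef, max_eq_left (le_of_lt (Set.mem_Ioi.1 hx))]
    simp
  have hF : Integrable F := by
    have := integrableOn_pow_mul_cexp_neg_mul (w := 1) (by simp) (m + 1)
    refine (integrableOn_iff_integrable_of_support_subset (s := Set.Ioi 0) ?_).1
      (this.congr_fun (fun x hx => (hFpos x hx).symm) measurableSet_Ioi)
    intro x hx
    by_contra h
    exact hx (hF0 x (not_lt.1 h))
  have hc : Continuous F := by fun_prop
  have hft : ∀ z : ℝ, ∫ x : ℝ, Complex.exp (Complex.I * (z * x)) * F x
      = (m + 1).factorial * (1 / (1 - Complex.I * z) ^ (m + 2)) := by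
    intro z
    rw [mul_one_div, ← integral_pow_mul_cexp_neg_mul_Ioi (w := 1 - Complex.I * z) (by simp) (m + 1),
      ← setIntegral_eq_integral_of_forall_compl_eq_zero (s := Set.Ioi 0)]
    · refine setIntegral_congr_fun measurableSet_Ioi fun x hx => ?_
      simp only [hFpos x hx]
      rw [mul_left_comm, ← Complex.exp_add]
      congr 2
      ring
    · intro x hx
      rw [hF0 x (not_lt.1 hx), mul_zero]
  have hfi : Integrable fun z : ℝ => ((m + 1).factorial : ℂ) * (1 / (1 - Complex.I * z) ^ (m + 2)) := by
    refine Integrable.const_mul ?_ _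
    simpa using integrable_cexp_mul_moebius 0 0 m
  have key := integral_cexp_mul_of_fourier_eq hF hc hfi hft a
  rw [hF0 _ (by linarith), mul_zero] at key
  simp_rw [mul_left_comm _ ((m + 1).factorial : ℂ)] at key
  rw [integral_const_mul] at key
  exact (mul_eq_zero.1 key).resolve_left (by exact_mod_cast Nat.factorial_ne_zero _)

/-- Writing `1 + i z = 2 - (1 - i z)` lowers `j` by one, which reduces everything to `j = 0`. -/
lemma integral_cexp_mul_moebius {a : ℝ} (ha : 0 ≤ a) (j m : ℕ) :
    ∫ z : ℝ, Complex.exp (Complex.I * (a * z)) *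
      ((1 + Complex.I * z : ℂ) ^ j / (1 - Complex.I * z) ^ (j + m + 2)) = 0 := by
  induction j generalizing m with
  | zero => simpa using integral_cexp_div_one_sub_I_mul_pow ha m
  | succ j ih =>
    have h : ∀ z : ℝ, Complex.exp (Complex.I * (a * z)) *
        ((1 + Complex.I * z : ℂ) ^ (j + 1) / (1 - Complex.I * z) ^ (j + 1 + m + 2))
        = 2 * (Complex.exp (Complex.I * (a * z)) *
            ((1 + Complex.I * z : ℂ) ^ j / (1 - Complex.I * z) ^ (j + (m + 1) + 2)))
          - Complex.exp (Complex.I * (a * z)) *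
            ((1 + Complex.I * z : ℂ) ^ j / (1 - Complex.I * z) ^ (j + m + 2)) := by
      intro z
      have := one_sub_I_mul_ne_zero z
      rw [show j + 1 + m + 2 = j + m + 2 + 1 by ring, show j + (m + 1) + 2 = j + m + 2 + 1 by ring]
      rw [pow_succ _ (j + m + 2), pow_succ _ j]
      field_simp
      ring
    simp_rw [h]
    rw [integral_sub ((integrable_cexp_mul_moebius a j (m + 1)).const_mul 2)
      (integrable_cexp_mul_moebius a j m), integral_const_mul, ih, ih]
    simp

lemma ofReal_one_add_sq (z : ℝ) :
    ((1 + z ^ 2 : ℝ) : ℂ) = (1 + Complex.I * z) * (1 - Complex.I * z) := by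
  push_cast
  linear_combination ((z : ℂ) ^ 2) * Complex.I_sq

/-- Fourier inversion for the Laplace density `exp (-|x|) / 2`. -/
lemma integral_cexp_mul_inv_one_add_sq {a : ℝ} (ha : 0 ≤ a) :
    ∫ z : ℝ, Complex.exp (Complex.I * (a * z)) * ((1 + z ^ 2 : ℝ) : ℂ)⁻¹
      = Real.pi * Complex.exp (-a) := by
  set F : ℝ → ℂ := fun x => Complex.exp (-(|x| : ℝ)) / 2 with hFdef
  have hc : Continuous F := by fun_prop
  have hsplit : ∀ z : ℝ, Integrable (fun x : ℝ => Complex.exp (Complex.I * (z * x)) * F x) ∧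
      ∫ x : ℝ, Complex.exp (Complex.I * (z * x)) * F x = ((1 + z ^ 2 : ℝ) : ℂ)⁻¹ := by
    intro z
    have e1 : ∀ x ∈ Set.Ioi (0 : ℝ), Complex.exp ((Complex.I * z - 1) * x) / 2 =
        Complex.exp (Complex.I * (z * x)) * F x := by
      intro x hx
      simp only [hFdef, abs_of_pos (Set.mem_Ioi.1 hx)]
      rw [← mul_div_assoc, ← Complex.exp_add]
      congr 2
      ring
    have e2 : ∀ x ∈ Set.Iic (0 : ℝ), Complex.exp ((Complex.I * z + 1) * x) / 2 =
        Complex.exp (Complex.I * (z * x)) * F x := by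
      intro x hx
      simp only [hFdef, abs_of_nonpos (Set.mem_Iic.1 hx)]
      rw [← mul_div_assoc, ← Complex.exp_add]
      congr 2
      push_cast
      ring
    have i1 := IntegrableOn.congr_fun ((integrableOn_exp_mul_complex_Ioi
      (a := Complex.I * z - 1) (by simp) 0).div_const 2) e1 measurableSet_Ioi
    have i2 := IntegrableOn.congr_fun ((integrableOn_exp_mul_complex_Iic
      (a := Complex.I * z + 1) (by simp) 0).div_const 2) e2 measurableSet_Iic
    constructor
    · rw [← integrableOn_univ, ← Set.Iic_union_Ioi (a := (0 : ℝ))]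
      exact i2.union i1
    · rw [← intervalIntegral.integral_Iic_add_Ioi i2 i1,
        ← setIntegral_congr_fun measurableSet_Ioi e1, ← setIntegral_congr_fun measurableSet_Iic e2,
        integral_div, integral_div, integral_exp_mul_complex_Ioi (by simp),
        integral_exp_mul_complex_Iic (by simp)]
      have h1 := one_sub_I_mul_ne_zero z
      have h2 := one_add_I_mul_ne_zero z
      rw [ofReal_one_add_sq, show Complex.I * z - 1 = -(1 - Complex.I * z) by ring,
        show Complex.I * z + 1 = 1 + Complex.I * z by ring]
      simp only [Complex.ofReal_zero, mul_zero, Complex.exp_zero, neg_div_neg_eq]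
      field_simp
      ring
  have hF : Integrable F := by simpa using (hsplit 0).1
  have hfi : Integrable fun z : ℝ => ((1 + z ^ 2 : ℝ) : ℂ)⁻¹ := by
    simpa using integrable_inv_one_add_sq.ofReal (𝕜 := ℂ)
  have key := integral_cexp_mul_of_fourier_eq hF hc hfi (fun z => (hsplit z).2) a
  rw [key]
  simp only [hFdef, abs_neg, abs_of_nonneg ha]
  ring

/-! ### Fourier transform of the mixture components. -/

/-- The one-variable factors in the binomial expansion of `mixComponent`. -/
noncomputable def moebiusFactor (n j : ℕ) (z : ℝ) : ℂ :=
  (1 + Complex.I * z) ^ j * (1 - Complex.I * z) ^ (2 * n - j) / ((1 + z ^ 2 : ℝ) : ℂ) ^ (n + 1)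

/-- Both `1 + i z` and `1 - i z` have modulus `√(1 + z²)`, so the numerator has modulus `(1 + z²) ^
n` whatever `j` is. -/
lemma norm_moebiusFactor {n j : ℕ} (hj : j ≤ 2 * n) (z : ℝ) :
    ‖moebiusFactor n j z‖ = (1 + z ^ 2)⁻¹ := by
  have h : 0 < 1 + z ^ 2 := by positivity
  rw [moebiusFactor, norm_div, norm_mul, norm_pow, norm_pow, norm_one_add_I_mul, ← pow_add,
    Nat.add_sub_cancel' hj, pow_mul, norm_sq_one_sub_I_mul, norm_pow, Complex.norm_real,
    Real.norm_of_nonneg h.le, pow_succ]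
  field_simp
  ring

lemma integrable_cexp_mul_moebiusFactor (a : ℝ) {n j : ℕ} (hj : j ≤ 2 * n) :
    Integrable fun z : ℝ => Complex.exp (Complex.I * (a * z)) * moebiusFactor n j z := by
  refine integrable_of_norm_le_inv_one_add_sq ?_ fun z => ?_
  · unfold moebiusFactor
    fun_prop
  · rw [norm_mul, norm_cexp_I_mul, one_mul, norm_moebiusFactor hj]

lemma integral_cexp_mul_moebiusFactor_self {a : ℝ} (ha : 0 ≤ a) (n : ℕ) :
    ∫ z : ℝ, Complex.exp (Complex.I * (a * z)) * moebiusFactor n n z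
      = Real.pi * Complex.exp (-a) := by
  rw [← integral_cexp_mul_inv_one_add_sq ha]
  congr 1
  ext z
  congr 1
  have h1 := one_sub_I_mul_ne_zero z
  have h2 := one_add_I_mul_ne_zero z
  rw [moebiusFactor, ofReal_one_add_sq, show 2 * n - n = n by omega, mul_pow]
  field_simp
  ring

lemma integral_cexp_mul_moebiusFactor_of_lt {a : ℝ} (ha : 0 ≤ a) {n j : ℕ} (hj : j ≤ 2 * n)
    (hnj : n < j) :
    ∫ z : ℝ, Complex.exp (Complex.I * (a * z)) * moebiusFactor n j z = 0 := by
  -- With `d = j - n - 1` and `e = 2n - j`, cancelling against `1 + z² = (1 + i z)(1 - i z)` leaves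
  -- `(1 + i z) ^ d / (1 - i z) ^ (d + 2)`.
  obtain ⟨d, rfl⟩ : ∃ d, j = n + 1 + d := ⟨j - (n + 1), by omega⟩
  obtain ⟨e, rfl⟩ : ∃ e, n = d + 1 + e := ⟨n - (d + 1), by omega⟩
  rw [← integral_cexp_mul_moebius ha d 0]
  congr 1
  ext z
  congr 1
  have h1 := one_sub_I_mul_ne_zero z
  have h2 := one_add_I_mul_ne_zero z
  rw [moebiusFactor, ofReal_one_add_sq,
    show 2 * (d + 1 + e) - (d + 1 + e + 1 + d) = e by omega, mul_pow, div_eq_div_iff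
      (by positivity) (by positivity)]
  ring

lemma mixComponent_eq_sum (n : ℕ) (z : ℝ × ℝ) :
    (mixComponent n z : ℂ) = 1 / ((Nat.choose (2 * n) n : ℂ) * Real.pi ^ 2) *
      ∑ j ∈ Finset.range (2 * n + 1), (Nat.choose (2 * n) j : ℂ) *
        (moebiusFactor n j z.1 * moebiusFactor n (2 * n - j) z.2) := by
  have hsum : ∑ j ∈ Finset.range (2 * n + 1), (Nat.choose (2 * n) j : ℂ) *
        (moebiusFactor n j z.1 * moebiusFactor n (2 * n - j) z.2)
      = ((2 : ℂ) * (1 + z.1 * z.2)) ^ (2 * n) /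
        (((1 + z.1 ^ 2 : ℝ) : ℂ) ^ (n + 1) * ((1 + z.2 ^ 2 : ℝ) : ℂ) ^ (n + 1)) := by
    rw [show (2 : ℂ) * (1 + z.1 * z.2) = (1 + Complex.I * z.1) * (1 - Complex.I * z.2) +
      (1 - Complex.I * z.1) * (1 + Complex.I * z.2) by
        linear_combination (2 * (z.1 : ℂ) * z.2) * Complex.I_sq, add_pow, Finset.sum_div]
    refine Finset.sum_congr rfl fun j hj => ?_
    have hj' : j ≤ 2 * n := by
      have := Finset.mem_range.1 hj
      omega
    rw [moebiusFactor, moebiusFactor, Nat.sub_sub_self hj', mul_pow, mul_pow]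
    ring
  rw [hsum, mixComponent, mul_pow]
  push_cast
  ring

lemma mixComponent_nonneg (n : ℕ) (z : ℝ × ℝ) : 0 ≤ mixComponent n z := by
  unfold mixComponent
  have : 0 ≤ (1 + z.1 * z.2) ^ (2 * n) := (even_two_mul n).pow_nonneg _
  positivity

lemma cexp_mul_mixComponent_eq_sum (n : ℕ) (a b : ℝ) (z : ℝ × ℝ) :
    Complex.exp (Complex.I * (a * z.1 + b * z.2)) * (mixComponent n z : ℂ) =
      1 / ((Nat.choose (2 * n) n : ℂ) * Real.pi ^ 2) *
      ∑ j ∈ Finset.range (2 * n + 1), (Nat.choose (2 * n) j : ℂ) *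
        ((Complex.exp (Complex.I * (a * z.1)) * moebiusFactor n j z.1) *
          (Complex.exp (Complex.I * (b * z.2)) * moebiusFactor n (2 * n - j) z.2)) := by
  rw [mixComponent_eq_sum, mul_left_comm, Finset.mul_sum]
  congr 1
  refine Finset.sum_congr rfl fun j _ => ?_
  rw [mul_add, Complex.exp_add]
  ring

lemma integrable_cexp_mul_mixComponent (n : ℕ) (a b : ℝ) :
    Integrable fun z : ℝ × ℝ =>
      Complex.exp (Complex.I * (a * z.1 + b * z.2)) * (mixComponent n z : ℂ) := by
  simp_rw [cexp_mul_mixComponent_eq_sum]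
  refine Integrable.const_mul (integrable_finsetSum _ fun j hj => Integrable.const_mul ?_ _) _
  have hj' : j ≤ 2 * n := by
    have := Finset.mem_range.1 hj
    omega
  exact (integrable_cexp_mul_moebiusFactor a hj').mul_prod
    (integrable_cexp_mul_moebiusFactor b (Nat.sub_le _ _))

lemma integrable_mixComponent (n : ℕ) : Integrable (mixComponent n) := by
  have h := (integrable_cexp_mul_mixComponent n 0 0).re
  simpa using h

/-- Both frequencies must have the same sign: the terms `j > n` are killed by the first variable and
the terms `j < n` by the second. -/
lemma integral_cexp_mul_mixComponent (n : ℕ) {a b : ℝ} (ha : 0 ≤ a) (hb : 0 ≤ b) :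
    ∫ z : ℝ × ℝ, Complex.exp (Complex.I * (a * z.1 + b * z.2)) * (mixComponent n z : ℂ)
      = Complex.exp (-(a + b)) := by
  simp_rw [cexp_mul_mixComponent_eq_sum]
  have hle : ∀ j ∈ Finset.range (2 * n + 1), j ≤ 2 * n := fun j hj => by
    have := Finset.mem_range.1 hj
    omega
  rw [integral_const_mul, integral_finsetSum]
  · simp_rw [integral_const_mul, Measure.volume_eq_prod]
    have hprod : ∀ j, ∫ z : ℝ × ℝ, (Complex.exp (Complex.I * (a * z.1)) * moebiusFactor n j z.1) *
        (Complex.exp (Complex.I * (b * z.2)) * moebiusFactor n (2 * n - j) z.2)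
          ∂((volume : Measure ℝ).prod volume)
        = (∫ x : ℝ, Complex.exp (Complex.I * (a * x)) * moebiusFactor n j x) *
          ∫ y : ℝ, Complex.exp (Complex.I * (b * y)) * moebiusFactor n (2 * n - j) y := fun j =>
      integral_prod_mul (fun x : ℝ => Complex.exp (Complex.I * (a * x)) * moebiusFactor n j x)
        (fun y : ℝ => Complex.exp (Complex.I * (b * y)) * moebiusFactor n (2 * n - j) y)
    simp_rw [hprod]
    rw [Finset.sum_eq_single n]
    · rw [show 2 * n - n = n by omega, integral_cexp_mul_moebiusFactor_self ha,
        integral_cexp_mul_moebiusFactor_self hb, neg_add, Complex.exp_add]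
      have h1 : (Nat.choose (2 * n) n : ℂ) ≠ 0 :=
        Nat.cast_ne_zero.2 (Nat.choose_pos (by omega)).ne'
      have h2 : (Real.pi : ℂ) ≠ 0 := by exact_mod_cast Real.pi_ne_zero
      field_simp
    · intro j hj hne
      rcases lt_or_gt_of_ne hne with h | h
      · rw [integral_cexp_mul_moebiusFactor_of_lt hb (j := 2 * n - j) (by omega) (by omega)]
        simp
      · rw [integral_cexp_mul_moebiusFactor_of_lt ha (hle j hj) h]
        simp
    · intro h
      exact absurd (Finset.mem_range.2 (by omega)) h
  · intro j hj
    exact ((integrable_cexp_mul_moebiusFactor a (hle j hj)).mul_prod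
      (integrable_cexp_mul_moebiusFactor b (Nat.sub_le _ _))).const_mul _

lemma integral_mixComponent (n : ℕ) : ∫ z, mixComponent n z = 1 := by
  have h := integral_cexp_mul_mixComponent n le_rfl le_rfl
  simp only [Complex.ofReal_zero, zero_mul, add_zero, mul_zero, Complex.exp_zero, one_mul,
    neg_zero] at h
  rw [integral_complex_ofReal] at h
  exact_mod_cast h

lemma measurable_mixComponent (n : ℕ) : Measurable (mixComponent n) := by
  unfold mixComponent
  fun_prop

/-! ### Characteristic functions and the Cauchy law. -/

lemma integral_densityMeasure {f : ℝ × ℝ → ℝ} (hm : Measurable f) (h0 : ∀ z, 0 ≤ f z)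
    (g : ℝ × ℝ → ℂ) : ∫ z, g z ∂(densityMeasure f) = ∫ z, g z * (f z : ℂ) := by
  rw [densityMeasure, integral_withDensity_eq_integral_toReal_smul (by fun_prop) (by simp)]
  congr 1
  ext z
  rw [ENNReal.toReal_ofReal (h0 z), Complex.real_smul, mul_comm]

lemma charFun_cauchyMeasure {t : ℝ} (ht : 0 ≤ t) :
    charFun (cauchyMeasure 0 1) t = Complex.exp (-t) := by
  rw [charFun_apply_real, cauchyMeasure_of_scale_ne_zero _ one_ne_zero,
    integral_withDensity_eq_integral_toReal_smul (by fun_prop) (by simp [cauchyPDF])]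
  have h := integral_cexp_mul_inv_one_add_sq ht
  have hpi : (Real.pi : ℂ) ≠ 0 := by exact_mod_cast Real.pi_ne_zero
  rw [← mul_right_inj' hpi, ← h, ← integral_const_mul]
  congr 1
  ext x
  rw [cauchyPDF, ENNReal.toReal_ofReal (cauchyPDF_pos 0 one_ne_zero x).le, cauchyPDFReal,
    Complex.real_smul]
  simp only [NNReal.coe_one, sub_zero, mul_one, one_pow]
  push_cast
  rw [show Complex.I * (t * x) = t * x * Complex.I by ring, add_comm ((x : ℂ) ^ 2)]
  field_simp

/-- Negating the argument conjugates a characteristic function, so the half-line on which the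
transforms were computed suffices. -/
lemma charFun_eq_of_nonneg {μ ν : Measure ℝ}
    (h : ∀ t, 0 ≤ t → charFun μ t = charFun ν t) : charFun μ = charFun ν := by
  ext t
  rcases le_total 0 t with ht | ht
  · exact h t ht
  · rw [← neg_neg t, charFun_neg, h (-t) (by linarith), ← charFun_neg]

lemma map_convexCombination_densityMeasure (n : ℕ) {w₁ w₂ : ℝ} (h₁ : 0 ≤ w₁) (h₂ : 0 ≤ w₂)
    (hw : w₁ + w₂ = 1) :
    (densityMeasure (mixComponent n)).map (fun z => w₁ * z.1 + w₂ * z.2) = cauchyMeasure 0 1 := by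
  have : IsFiniteMeasure (densityMeasure (mixComponent n)) :=
    isFiniteMeasure_withDensity_ofReal (integrable_mixComponent n).2
  refine Measure.ext_of_charFun (charFun_eq_of_nonneg fun t ht => ?_)
  rw [charFun_cauchyMeasure ht, charFun_apply_real, integral_map (by fun_prop) (by fun_prop),
    integral_densityMeasure (measurable_mixComponent n) (mixComponent_nonneg n)]
  have h := integral_cexp_mul_mixComponent n (mul_nonneg ht h₁) (mul_nonneg ht h₂)
  have e : -((t : ℂ)) = -(((t * w₁ : ℝ) : ℂ) + ((t * w₂ : ℝ) : ℂ)) := by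
    rw [← Complex.ofReal_add, ← mul_add, hw, mul_one]
  rw [e, ← h]
  congr 1
  ext z
  congr 2
  push_cast
  ring

lemma hasLaw_convexCombination {Ω : Type*} [MeasurableSpace Ω] {P : Measure Ω} {C₁ C₂ : Ω → ℝ}
    {n : ℕ} (hC : HasLaw (fun ω => (C₁ ω, C₂ ω)) (densityMeasure (mixComponent n)) P)
    {w₁ w₂ : ℝ} (h₁ : 0 ≤ w₁) (h₂ : 0 ≤ w₂) (hw : w₁ + w₂ = 1) :
    HasLaw (fun ω => w₁ * C₁ ω + w₂ * C₂ ω) (cauchyMeasure 0 1) P :=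
  HasLaw.fun_comp (Y := fun z : ℝ × ℝ => w₁ * z.1 + w₂ * z.2)
    ⟨by fun_prop, map_convexCombination_densityMeasure n h₁ h₂ hw⟩ hC

/-! ### Density of the correlated Gaussian law. -/

lemma corrMatrix_posSemidef {ρ : ℝ} (h₁ : -1 < ρ) (h₂ : ρ < 1) : (corrMatrix ρ).PosSemidef := by
  refine Matrix.PosSemidef.of_dotProduct_mulVec_nonneg ?_ fun x => ?_
  · ext i j
    fin_cases i <;> fin_cases j <;> simp [corrMatrix]
  · simp [corrMatrix, Matrix.mulVec, dotProduct, Fin.sum_univ_two]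
    nlinarith [mul_nonneg (by linarith : 0 ≤ 1 + ρ) (sq_nonneg (x 0 + x 1)),
      mul_nonneg (by linarith : 0 ≤ 1 - ρ) (sq_nonneg (x 0 - x 1))]

lemma one_sub_sq_pos {ρ : ℝ} (h₁ : -1 < ρ) (h₂ : ρ < 1) : 0 < 1 - ρ ^ 2 := by nlinarith

/-- The linear map is a Cholesky factor of the correlation matrix, and the characteristic functions
agree. -/
lemma multivariateGaussian_corrMatrix_eq_map {ρ : ℝ} (h₁ : -1 < ρ) (h₂ : ρ < 1) :
    multivariateGaussian 0 (corrMatrix ρ) = ((gaussianReal 0 1).prod (gaussianReal 0 1)).map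
      (fun g => !₂[g.1, ρ * g.1 + √(1 - ρ ^ 2) * g.2]) := by
  have hmeas : Measurable fun g : ℝ × ℝ => !₂[g.1, ρ * g.1 + √(1 - ρ ^ 2) * g.2] := by fun_prop
  have : IsProbabilityMeasure (((gaussianReal 0 1).prod (gaussianReal 0 1)).map
      (fun g => !₂[g.1, ρ * g.1 + √(1 - ρ ^ 2) * g.2])) :=
    Measure.isProbabilityMeasure_map hmeas.aemeasurable
  refine Measure.ext_of_charFun ?_
  ext t
  rw [charFun_multivariateGaussian (corrMatrix_posSemidef h₁ h₂), charFun_apply,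
    integral_map hmeas.aemeasurable (by fun_prop)]
  have hs : √(1 - ρ ^ 2) ^ 2 = 1 - ρ ^ 2 := Real.sq_sqrt (one_sub_sq_pos h₁ h₂).le
  have e : ∀ g : ℝ × ℝ,
      Complex.exp (↑(inner ℝ !₂[g.1, ρ * g.1 + √(1 - ρ ^ 2) * g.2] t) * Complex.I)
      = Complex.exp (↑(t 0 + ρ * t 1) * g.1 * Complex.I) *
        Complex.exp (↑(√(1 - ρ ^ 2) * t 1) * g.2 * Complex.I) := by
    intro g
    rw [← Complex.exp_add]
    congr 1
    simp [PiLp.inner_apply, Fin.sum_univ_two]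
    ring
  simp_rw [e]
  rw [integral_prod_mul (fun x : ℝ => Complex.exp (((t 0 + ρ * t 1 : ℝ) : ℂ) * x * Complex.I))
    (fun y : ℝ => Complex.exp (((√(1 - ρ ^ 2) * t 1 : ℝ) : ℂ) * y * Complex.I)), ← charFun_apply_real,
    ← charFun_apply_real, charFun_gaussianReal, charFun_gaussianReal, ← Complex.exp_add]
  congr 1
  have hs' : (√(1 - ρ ^ 2) : ℂ) ^ 2 = 1 - ρ ^ 2 := by exact_mod_cast hs
  simp [corrMatrix, Matrix.mulVec, dotProduct, Fin.sum_univ_two]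
  linear_combination ((t 1 : ℂ) ^ 2 / 2) * hs'

/-- The density of the centred bivariate Gaussian law with unit variances and correlation `ρ`. -/
noncomputable def gaussianDensity (ρ : ℝ) (x : ℝ × ℝ) : ℝ :=
  (2 * Real.pi * √(1 - ρ ^ 2))⁻¹ *
    Real.exp (-(x.1 ^ 2 - 2 * ρ * x.1 * x.2 + x.2 ^ 2) / (2 * (1 - ρ ^ 2)))

lemma measurable_gaussianDensity (ρ : ℝ) : Measurable (gaussianDensity ρ) := by
  unfold gaussianDensity
  fun_prop

lemma gaussianDensity_nonneg (ρ : ℝ) (x : ℝ × ℝ) : 0 ≤ gaussianDensity ρ x := by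
  unfold gaussianDensity
  positivity

lemma gaussianPDF_mul_gaussianPDF {ρ : ℝ} (h₁ : -1 < ρ) (h₂ : ρ < 1) (x y : ℝ) :
    gaussianPDF 0 1 x * gaussianPDF (ρ * x) (1 - ρ ^ 2).toNNReal y
      = ENNReal.ofReal (gaussianDensity ρ (x, y)) := by
  have hs := one_sub_sq_pos h₁ h₂
  rw [gaussianPDF, gaussianPDF, ← ENNReal.ofReal_mul (gaussianPDFReal_nonneg _ _ _)]
  congr 1
  rw [gaussianPDFReal, gaussianPDFReal, gaussianDensity, Real.coe_toNNReal _ hs.le,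
    mul_mul_mul_comm, ← Real.exp_add, ← mul_inv, ← Real.sqrt_mul (by simp; positivity)]
  congr 2
  · rw [show 2 * Real.pi * ((1 : NNReal) : ℝ) * (2 * Real.pi * (1 - ρ ^ 2))
      = (2 * Real.pi) ^ 2 * (1 - ρ ^ 2) by simp; ring, Real.sqrt_mul (by positivity),
      Real.sqrt_sq (by positivity)]
  · simp only [NNReal.coe_one]
    field_simp
    ring

lemma map_multivariateGaussian_corrMatrix {ρ : ℝ} (h₁ : -1 < ρ) (h₂ : ρ < 1) :
    (multivariateGaussian 0 (corrMatrix ρ)).map (fun x => (x 0, x 1))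
      = densityMeasure (gaussianDensity ρ) := by
  have hs := one_sub_sq_pos h₁ h₂
  have hd := measurable_gaussianDensity ρ
  rw [multivariateGaussian_corrMatrix_eq_map h₁ h₂, Measure.map_map (by fun_prop) (by fun_prop)]
  refine Measure.ext_of_lintegral _ fun F hF => ?_
  rw [lintegral_map hF (by fun_prop), lintegral_prod _ (by fun_prop), densityMeasure,
    lintegral_withDensity_eq_lintegral_mul _ (by fun_prop) hF, Measure.volume_eq_prod,
    lintegral_prod _ (by fun_prop), gaussianReal_of_var_ne_zero _ one_ne_zero,
    lintegral_withDensity_eq_lintegral_mul _ (by fun_prop) (by fun_prop)]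
  congr 1
  ext x
  -- The conditional law of the second coordinate, given that the first equals `x`.
  have hmap : (gaussianReal 0 1).map (fun y => ρ * x + √(1 - ρ ^ 2) * y)
      = gaussianReal (ρ * x) (1 - ρ ^ 2).toNNReal := by
    rw [← Function.comp_def (fun y => ρ * x + y), ← Measure.map_map (by fun_prop) (by fun_prop),
      gaussianReal_map_const_mul, gaussianReal_map_const_add]
    congr 1
    · simp
    · ext
      simp [Real.sq_sqrt hs.le, hs.le]
  have hv : (1 - ρ ^ 2).toNNReal ≠ 0 := by simpa using hs
  have hinner : ∫⁻ y, F (x, ρ * x + √(1 - ρ ^ 2) * y) ∂(gaussianReal 0 1)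
      = ∫⁻ y, F (x, y) ∂(gaussianReal (ρ * x) (1 - ρ ^ 2).toNNReal) := by
    rw [← hmap, lintegral_map (by fun_prop) (by fun_prop)]
  rw [gaussianReal_of_var_ne_zero _ hv,
    lintegral_withDensity_eq_lintegral_mul _ (by fun_prop) (by fun_prop)] at hinner
  simp only [Pi.mul_apply, Function.comp_apply]
  rw [← gaussianReal_of_var_ne_zero _ one_ne_zero]
  simp only [Matrix.cons_val_zero, Matrix.cons_val_one]
  rw [hinner, ← lintegral_const_mul _ (by fun_prop)]
  congr 1
  ext y
  rw [← gaussianPDF_mul_gaussianPDF h₁ h₂, Pi.mul_apply, mul_assoc]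

/-! ### Law of a coordinatewise ratio. -/

lemma lintegral_eq_abs_mul_lintegral_comp_mul {y : ℝ} (hy : y ≠ 0) {G : ℝ → ENNReal}
    (hG : Measurable G) : ∫⁻ x, G x = ENNReal.ofReal |y| * ∫⁻ z, G (y * z) := by
  rw [← lintegral_map (f := G) hG (by fun_prop : Measurable fun z : ℝ => y * z),
    Real.map_volume_mul_left hy, lintegral_smul_measure, smul_eq_mul, ← mul_assoc,
    ← ENNReal.ofReal_mul (abs_nonneg _), abs_inv, mul_inv_cancel₀ (abs_ne_zero.2 hy),
    ENNReal.ofReal_one, one_mul]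

lemma lintegral_prod_eq_abs_mul_lintegral_comp_mul {y : ℝ × ℝ} (h₁ : y.1 ≠ 0) (h₂ : y.2 ≠ 0)
    {G : ℝ × ℝ → ENNReal} (hG : Measurable G) :
    ∫⁻ x, G x = ENNReal.ofReal |y.1 * y.2| * ∫⁻ z : ℝ × ℝ, G (y.1 * z.1, y.2 * z.2) := by
  rw [Measure.volume_eq_prod, lintegral_prod _ hG.aemeasurable, lintegral_prod _ (by fun_prop),
    lintegral_eq_abs_mul_lintegral_comp_mul h₁ (hG.lintegral_prod_right'), abs_mul,
    ENNReal.ofReal_mul (abs_nonneg _), mul_assoc]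
  congr 1
  have hm : Measurable fun z : ℝ × ℝ => G (y.1 * z.1, y.2 * z.2) := by fun_prop
  rw [← lintegral_const_mul _ hm.lintegral_prod_right']
  congr 1
  ext x
  exact lintegral_eq_abs_mul_lintegral_comp_mul h₂ (by fun_prop)

lemma lintegral_densityMeasure {p : ℝ × ℝ → ℝ} (hp : Measurable p) {F : ℝ × ℝ → ENNReal}
    (hF : Measurable F) :
    ∫⁻ x, F x ∂(densityMeasure p) = ∫⁻ x, ENNReal.ofReal (p x) * F x :=
  lintegral_withDensity_eq_lintegral_mul _ (by fun_prop) hF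

/-- The law of the coordinatewise ratio of two independent vectors with densities. -/
lemma map_ratio_prod_densityMeasure {p f : ℝ × ℝ → ℝ} (hp : Measurable p) (hf : Measurable f)
    (h : ∀ z : ℝ × ℝ, ∫⁻ y : ℝ × ℝ, ENNReal.ofReal (p y) * (ENNReal.ofReal |y.1 * y.2| *
      ENNReal.ofReal (p (y.1 * z.1, y.2 * z.2))) = ENNReal.ofReal (f z))
    [SFinite (densityMeasure p)] :
    ((densityMeasure p).prod (densityMeasure p)).map
      (fun q : (ℝ × ℝ) × (ℝ × ℝ) => (q.1.1 / q.2.1, q.1.2 / q.2.2)) = densityMeasure f := by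
  refine Measure.ext_of_lintegral _ fun F hF => ?_
  -- The substitution `x = y z` needs both coordinates of `y` nonzero; the axes are null.
  have hy : ∀ᵐ y : ℝ × ℝ, y.1 ≠ 0 ∧ y.2 ≠ 0 := by
    rw [Measure.volume_eq_prod]
    have h0 : ∀ᵐ x : ℝ, x ≠ 0 := Measure.ae_ne volume 0
    filter_upwards [Measure.quasiMeasurePreserving_fst.ae h0,
      Measure.quasiMeasurePreserving_snd.ae h0] with y a b using ⟨a, b⟩
  have hm : Measurable fun q : (ℝ × ℝ) × (ℝ × ℝ) => F (q.1.1 / q.2.1, q.1.2 / q.2.2) := by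
    fun_prop
  rw [lintegral_map hF (by fun_prop), lintegral_prod_symm' _ hm,
    lintegral_densityMeasure hp hm.lintegral_prod_left', lintegral_densityMeasure hf hF]
  calc _ = ∫⁻ y : ℝ × ℝ, ∫⁻ z : ℝ × ℝ, F z * (ENNReal.ofReal (p y) * (ENNReal.ofReal |y.1 * y.2| *
      ENNReal.ofReal (p (y.1 * z.1, y.2 * z.2)))) := by
        refine lintegral_congr_ae ?_
        filter_upwards [hy] with y hy
        rw [lintegral_densityMeasure hp (by fun_prop),
          lintegral_prod_eq_abs_mul_lintegral_comp_mul hy.1 hy.2 (by fun_prop),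
          ← lintegral_const_mul _ (by fun_prop), ← lintegral_const_mul _ (by fun_prop)]
        congr 1
        ext z
        simp only [mul_div_cancel_left₀ _ hy.1, mul_div_cancel_left₀ _ hy.2]
        ring
    _ = ∫⁻ z : ℝ × ℝ, ∫⁻ y : ℝ × ℝ, F z * (ENNReal.ofReal (p y) * (ENNReal.ofReal |y.1 * y.2| *
      ENNReal.ofReal (p (y.1 * z.1, y.2 * z.2)))) := by
        rw [lintegral_lintegral_swap]
        fun_prop
    _ = _ := by
        congr 1
        ext z
        rw [lintegral_const_mul _ (by fun_prop), h, mul_comm]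

/-! ### Gaussian moments and the mixture series. -/

/-- The integrand of the odd absolute Gaussian moments. -/
noncomputable def absGaussianMoment (n : ℕ) (α y : ℝ) : ℝ :=
  |y| ^ (2 * n + 1) * Real.exp (-(α / 2) * y ^ 2)

lemma absGaussianMoment_nonneg (n : ℕ) (α y : ℝ) : 0 ≤ absGaussianMoment n α y := by
  unfold absGaussianMoment
  positivity

lemma measurable_absGaussianMoment (n : ℕ) (α : ℝ) : Measurable (absGaussianMoment n α) := by
  unfold absGaussianMoment
  fun_prop

lemma integral_absGaussianMoment (n : ℕ) {α : ℝ} (hα : 0 < α) :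
    ∫ y, absGaussianMoment n α y = 2 ^ (n + 1) * n.factorial / α ^ (n + 1) := by
  have h := integral_rpow_mul_exp_neg_mul_rpow (p := 2) (q := ((2 * n + 1 : ℕ) : ℝ)) (b := α / 2)
    two_pos (by have : (0 : ℝ) ≤ ((2 * n + 1 : ℕ) : ℝ) := Nat.cast_nonneg _
                linarith) (by positivity)
  have h2 := integral_comp_abs (f := fun y => y ^ (2 * n + 1) * Real.exp (-(α / 2) * y ^ 2))
  simp only [sq_abs] at h2
  simp only [absGaussianMoment, h2]
  simp only [Real.rpow_natCast, Real.rpow_two] at h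
  rw [h, show (((2 * n + 1 : ℕ) : ℝ) + 1) / 2 = n + 1 by push_cast; ring, Real.Gamma_nat_eq_factorial,
    show -(((2 * n + 1 : ℕ) : ℝ) + 1) / 2 = -((n + 1 : ℕ) : ℝ) by push_cast; ring,
    Real.rpow_neg (by positivity), Real.rpow_natCast, div_pow]
  field_simp

lemma lintegral_absGaussianMoment (n : ℕ) {α : ℝ} (hα : 0 < α) :
    ∫⁻ y, ENNReal.ofReal (absGaussianMoment n α y)
      = ENNReal.ofReal (2 ^ (n + 1) * n.factorial / α ^ (n + 1)) := by
  rw [← integral_absGaussianMoment n hα, ofReal_integral_eq_lintegral_ofReal]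
  -- A non-integrable function has integral `0` by convention, so a nonzero value proves
  -- integrability.
  · refine Integrable.of_integral_ne_zero ?_
    rw [integral_absGaussianMoment n hα]
    positivity
  · exact Filter.Eventually.of_forall (absGaussianMoment_nonneg n α)

/-- The bounds `4 ^ n ≤ (2n + 1) C(2n, n)` and, by Cauchy–Schwarz, `(1 + z₁ z₂)² ≤ (1 + z₁²)(1 +
z₂²)` dominate the series by one of the form `∑ (2n + 1) ρ ^ (2n)`. -/
lemma summable_pow_mul_mixComponent {ρ : ℝ} (h₁ : -1 < ρ) (h₂ : ρ < 1) (z : ℝ × ℝ) :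
    Summable fun n : ℕ => ρ ^ (2 * n) * mixComponent n z := by
  have hr : ‖ρ ^ 2‖ < 1 := by
    rw [Real.norm_of_nonneg (sq_nonneg ρ)]
    nlinarith
  have hs : Summable fun n : ℕ => (2 * ((n : ℝ) ^ 1 * (ρ ^ 2) ^ n) + (ρ ^ 2) ^ n) *
      (1 / Real.pi ^ 2) :=
    (((summable_pow_mul_geometric_of_norm_lt_one 1 hr).mul_left 2).add
      (summable_geometric_of_norm_lt_one hr)).mul_right _
  refine hs.of_nonneg_of_le (fun n => mul_nonneg ?_ (mixComponent_nonneg n z)) fun n => ?_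
  · exact (even_two_mul n).pow_nonneg _
  have hC : (0 : ℝ) < Nat.choose (2 * n) n := by exact_mod_cast Nat.choose_pos (by omega)
  have h4 : (2 : ℝ) ^ (2 * n) / Nat.choose (2 * n) n ≤ 2 * n + 1 := by
    rw [div_le_iff₀ hC, pow_mul]
    norm_num
    exact_mod_cast Nat.four_pow_le_two_mul_add_one_mul_central_binom n
  have hq : (1 + z.1 * z.2) ^ (2 * n) / ((1 + z.1 ^ 2) ^ (n + 1) * (1 + z.2 ^ 2) ^ (n + 1)) ≤ 1 := by
    rw [div_le_one (by positivity), pow_mul, ← mul_pow]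
    have hge : 1 ≤ (1 + z.1 ^ 2) * (1 + z.2 ^ 2) := by
      nlinarith [sq_nonneg z.1, sq_nonneg z.2, mul_nonneg (sq_nonneg z.1) (sq_nonneg z.2)]
    calc ((1 + z.1 * z.2) ^ 2) ^ n ≤ ((1 + z.1 ^ 2) * (1 + z.2 ^ 2)) ^ n := by
          gcongr
          nlinarith [sq_nonneg (z.1 - z.2)]
      _ ≤ _ := pow_le_pow_right₀ hge (Nat.le_succ n)
  have hq0 : 0 ≤ (1 + z.1 * z.2) ^ (2 * n) / ((1 + z.1 ^ 2) ^ (n + 1) * (1 + z.2 ^ 2) ^ (n + 1)) :=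
    div_nonneg ((even_two_mul n).pow_nonneg _) (by positivity)
  calc ρ ^ (2 * n) * mixComponent n z
      ≤ (ρ ^ 2) ^ n * ((2 * n + 1) * (1 / Real.pi ^ 2) * 1) := by
        rw [mixComponent, pow_mul]
        gcongr
    _ = _ := by ring

lemma lintegral_eq_half_lintegral_add_comp_neg_fst {G : ℝ × ℝ → ENNReal} (hG : Measurable G) :
    ∫⁻ y, G y = ∫⁻ y : ℝ × ℝ, 2⁻¹ * (G y + G (-y.1, y.2)) := by
  have h : ∫⁻ y : ℝ × ℝ, G (-y.1, y.2) = ∫⁻ y, G y :=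
    ((Measure.measurePreserving_neg (volume : Measure ℝ)).prod
      (MeasurePreserving.id (volume : Measure ℝ))).lintegral_comp hG
  rw [lintegral_const_mul _ (by fun_prop), lintegral_add_left hG, h, ← two_mul, ← mul_assoc,
    ENNReal.inv_mul_cancel two_ne_zero ENNReal.ofNat_ne_top, one_mul]

/-- Averaging over `y₁ ↦ -y₁` replaces `exp (c y₁ y₂)` by `cosh (c y₁ y₂)`. Its Taylor coefficients
are nonnegative and its terms even, so Tonelli applies and each term splits into a product of two
moments, for either sign of `c`. -/
lemma lintegral_abs_mul_mul_exp {α β c : ℝ} (hα : 0 < α) (hβ : 0 < β) :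
    ∫⁻ y : ℝ × ℝ, ENNReal.ofReal (|y.1 * y.2| *
        Real.exp (-(α / 2) * y.1 ^ 2 + -(β / 2) * y.2 ^ 2 + c * (y.1 * y.2)))
      = ∑' n : ℕ, ENNReal.ofReal (c ^ (2 * n) / (2 * n).factorial *
        ((2 ^ (n + 1) * n.factorial / α ^ (n + 1)) * (2 ^ (n + 1) * n.factorial / β ^ (n + 1)))) := by
  have key : ∀ y : ℝ × ℝ, (2 : ENNReal)⁻¹ * (ENNReal.ofReal (|y.1 * y.2| *
        Real.exp (-(α / 2) * y.1 ^ 2 + -(β / 2) * y.2 ^ 2 + c * (y.1 * y.2)))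
      + ENNReal.ofReal (|-y.1 * y.2| *
        Real.exp (-(α / 2) * (-y.1) ^ 2 + -(β / 2) * y.2 ^ 2 + c * (-y.1 * y.2))))
      = ∑' n : ℕ, ENNReal.ofReal (c ^ (2 * n) / (2 * n).factorial) *
        (ENNReal.ofReal (absGaussianMoment n α y.1) *
          ENNReal.ofReal (absGaussianMoment n β y.2)) := by
    intro y
    have hc := (Real.hasSum_cosh (c * (y.1 * y.2))).mul_left (|y.1 * y.2| *
      (Real.exp (-(α / 2) * y.1 ^ 2) * Real.exp (-(β / 2) * y.2 ^ 2)))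
    have hn : ∀ n : ℕ, 0 ≤ c ^ (2 * n) / ((2 * n).factorial : ℝ) := fun n =>
      div_nonneg ((even_two_mul n).pow_nonneg _) (by positivity)
    have hterm : ∀ n : ℕ, |y.1 * y.2| *
        (Real.exp (-(α / 2) * y.1 ^ 2) * Real.exp (-(β / 2) * y.2 ^ 2)) *
          ((c * (y.1 * y.2)) ^ (2 * n) / (2 * n).factorial)
        = c ^ (2 * n) / (2 * n).factorial *
          (absGaussianMoment n α y.1 * absGaussianMoment n β y.2) := by
      intro n
      rw [absGaussianMoment, absGaussianMoment, pow_succ _ (2 * n), pow_succ _ (2 * n),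
        (even_two_mul n).pow_abs, (even_two_mul n).pow_abs, abs_mul, mul_pow, mul_pow]
      ring
    simp_rw [hterm] at hc
    have hnn : ∀ n : ℕ, 0 ≤ c ^ (2 * n) / ((2 * n).factorial : ℝ) *
          (absGaussianMoment n α y.1 * absGaussianMoment n β y.2) := fun n =>
      mul_nonneg (hn n) (mul_nonneg (absGaussianMoment_nonneg _ _ _)
        (absGaussianMoment_nonneg _ _ _))
    have hR := ENNReal.ofReal_tsum_of_nonneg hnn hc.summable
    rw [hc.tsum_eq] at hR
    simp_rw [ENNReal.ofReal_mul (hn _), ENNReal.ofReal_mul (absGaussianMoment_nonneg _ _ _)] at hR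
    rw [← hR, ← ENNReal.ofReal_add (by positivity) (by positivity),
      show (2 : ENNReal)⁻¹ = ENNReal.ofReal 2⁻¹ by
        rw [ENNReal.ofReal_inv_of_pos two_pos, ENNReal.ofReal_ofNat],
      ← ENNReal.ofReal_mul (by positivity), Real.cosh_eq, neg_mul y.1, abs_neg, neg_sq,
      Real.exp_add _ (c * (y.1 * y.2)),
      Real.exp_add _ (c * -(y.1 * y.2)), Real.exp_add, mul_neg]
    congr 1
    ring
  rw [lintegral_eq_half_lintegral_add_comp_neg_fst (by fun_prop)]
  simp_rw [key]
  have hmα := fun n => measurable_absGaussianMoment n α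
  have hmβ := fun n => measurable_absGaussianMoment n β
  rw [lintegral_tsum fun n => by fun_prop]
  congr 1
  ext n
  have hn : 0 ≤ c ^ (2 * n) / ((2 * n).factorial : ℝ) :=
    div_nonneg ((even_two_mul n).pow_nonneg _) (by positivity)
  rw [lintegral_const_mul _ (by fun_prop), Measure.volume_eq_prod,
    lintegral_prod_mul (f := fun x => ENNReal.ofReal (absGaussianMoment n α x))
      (g := fun x => ENNReal.ofReal (absGaussianMoment n β x)) (by fun_prop) (by fun_prop),
    lintegral_absGaussianMoment n hα, lintegral_absGaussianMoment n hβ,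
    ← ENNReal.ofReal_mul (by positivity), ← ENNReal.ofReal_mul hn]

lemma lintegral_gaussianDensity_ratio {ρ : ℝ} (h₁ : -1 < ρ) (h₂ : ρ < 1) (z : ℝ × ℝ) :
    ∫⁻ y : ℝ × ℝ, ENNReal.ofReal (gaussianDensity ρ y) * (ENNReal.ofReal |y.1 * y.2| *
      ENNReal.ofReal (gaussianDensity ρ (y.1 * z.1, y.2 * z.2)))
      = ENNReal.ofReal ((1 - ρ ^ 2) * ∑' n : ℕ, ρ ^ (2 * n) * mixComponent n z) := by
  have hs := one_sub_sq_pos h₁ h₂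
  set s := 1 - ρ ^ 2 with hsdef
  have hpt : ∀ y : ℝ × ℝ, ENNReal.ofReal (gaussianDensity ρ y) * (ENNReal.ofReal |y.1 * y.2| *
      ENNReal.ofReal (gaussianDensity ρ (y.1 * z.1, y.2 * z.2)))
      = ENNReal.ofReal ((2 * Real.pi) ^ 2 * s)⁻¹ * ENNReal.ofReal (|y.1 * y.2| *
        Real.exp (-(((1 + z.1 ^ 2) / s) / 2) * y.1 ^ 2 + -(((1 + z.2 ^ 2) / s) / 2) * y.2 ^ 2
          + (ρ * (1 + z.1 * z.2) / s) * (y.1 * y.2))) := by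
    intro y
    rw [← ENNReal.ofReal_mul (abs_nonneg _), ← ENNReal.ofReal_mul (gaussianDensity_nonneg _ _),
      ← ENNReal.ofReal_mul (by positivity)]
    congr 1
    -- Collecting the two quadratic forms gives `α = (1 + z₁²) / s`, `β = (1 + z₂²) / s` and `c = ρ
    -- (1 + z₁ z₂) / s`.
    have he : Real.exp (-(((1 + z.1 ^ 2) / s) / 2) * y.1 ^ 2 +
          -(((1 + z.2 ^ 2) / s) / 2) * y.2 ^ 2 + (ρ * (1 + z.1 * z.2) / s) * (y.1 * y.2))
        = Real.exp (-(y.1 ^ 2 - 2 * ρ * y.1 * y.2 + y.2 ^ 2) / (2 * s)) *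
          Real.exp (-((y.1 * z.1) ^ 2 - 2 * ρ * (y.1 * z.1) * (y.2 * z.2) + (y.2 * z.2) ^ 2) /
            (2 * s)) := by
      rw [← Real.exp_add]
      congr 1
      field_simp
      ring
    have hc : ((2 * Real.pi) ^ 2 * s)⁻¹ = (2 * Real.pi * √s)⁻¹ * (2 * Real.pi * √s)⁻¹ := by
      rw [← mul_inv, mul_mul_mul_comm, Real.mul_self_sqrt hs.le, sq]
    rw [gaussianDensity, gaussianDensity, ← hsdef, he, hc]
    ring
  simp_rw [hpt]
  have hm : Measurable fun y : ℝ × ℝ => ENNReal.ofReal (|y.1 * y.2| *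
        Real.exp (-(((1 + z.1 ^ 2) / s) / 2) * y.1 ^ 2 + -(((1 + z.2 ^ 2) / s) / 2) * y.2 ^ 2
          + (ρ * (1 + z.1 * z.2) / s) * (y.1 * y.2))) := by fun_prop
  have hnn : ∀ n : ℕ, 0 ≤ s * (ρ ^ (2 * n) * mixComponent n z) := fun n =>
    mul_nonneg hs.le (mul_nonneg ((even_two_mul n).pow_nonneg _) (mixComponent_nonneg n z))
  rw [lintegral_const_mul _ hm, lintegral_abs_mul_mul_exp (by positivity) (by positivity),
    ← tsum_mul_left, ENNReal.ofReal_tsum_of_nonneg hnn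
      ((summable_pow_mul_mixComponent h₁ h₂ z).mul_left s), ← ENNReal.tsum_mul_left]
  congr 1
  ext n
  rw [← ENNReal.ofReal_mul (by positivity)]
  congr 1
  -- The moments contribute `(n!)² / (2n)!`, the inverse central binomial coefficient; the powers of
  -- `s` collapse to a single factor `s`.
  have hC : (Nat.choose (2 * n) n : ℝ) = (2 * n).factorial / (n.factorial * n.factorial) := by
    rw [Nat.cast_choose ℝ (by omega), show 2 * n - n = n by omega]
  have ha : 1 + z.1 ^ 2 ≠ 0 := by positivity
  have hb : 1 + z.2 ^ 2 ≠ 0 := by positivity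
  have hf1 : (n.factorial : ℝ) ≠ 0 := by positivity
  have hf2 : ((2 * n).factorial : ℝ) ≠ 0 := by positivity
  rw [mixComponent, hC]
  simp only [div_pow, mul_pow]
  field_simp
  ring

/-- The terms are nonnegative and summable, so the real sum is the `toReal` of an `ENNReal` sum,
which is measurable termwise. -/
lemma measurable_tsum_mixComponent {ρ : ℝ} (h₁ : -1 < ρ) (h₂ : ρ < 1) :
    Measurable fun z : ℝ × ℝ => (1 - ρ ^ 2) * ∑' n : ℕ, ρ ^ (2 * n) * mixComponent n z := by
  have : (fun z : ℝ × ℝ => ∑' n : ℕ, ρ ^ (2 * n) * mixComponent n z)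
      = fun z => (∑' n : ℕ, ENNReal.ofReal (ρ ^ (2 * n) * mixComponent n z)).toReal := by
    ext z
    have hnn : ∀ n : ℕ, 0 ≤ ρ ^ (2 * n) * mixComponent n z := fun n =>
      mul_nonneg ((even_two_mul n).pow_nonneg _) (mixComponent_nonneg n z)
    rw [← ENNReal.ofReal_tsum_of_nonneg hnn (summable_pow_mul_mixComponent h₁ h₂ z),
      ENNReal.toReal_ofReal (tsum_nonneg hnn)]
  refine Measurable.const_mul ?_ _
  rw [this]
  refine (Measurable.tsum fun n => ?_).ennreal_toReal
  have := measurable_mixComponent n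
  fun_prop

/-! ### Assembly of the two statements. -/

lemma hasLaw_ratio {Ω : Type*} [MeasurableSpace Ω] {P : Measure Ω} [IsProbabilityMeasure P]
    {ρ : ℝ} (h₁ : -1 < ρ) (h₂ : ρ < 1) {X Y : Ω → EuclideanSpace ℝ (Fin 2)}
    (hX : HasLaw X (multivariateGaussian 0 (corrMatrix ρ)) P)
    (hY : HasLaw Y (multivariateGaussian 0 (corrMatrix ρ)) P) (hXY : IndepFun X Y P) :
    HasLaw (fun ω => (X ω 0 / Y ω 0, X ω 1 / Y ω 1))
      (densityMeasure (fun z => (1 - ρ ^ 2) * ∑' n : ℕ, ρ ^ (2 * n) * mixComponent n z)) P := by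
  have hc : Measurable fun x : EuclideanSpace ℝ (Fin 2) => (x 0, x 1) := by fun_prop
  have hlaw : HasLaw (fun x : EuclideanSpace ℝ (Fin 2) => (x 0, x 1))
      (densityMeasure (gaussianDensity ρ)) (multivariateGaussian 0 (corrMatrix ρ)) :=
    ⟨hc.aemeasurable, map_multivariateGaussian_corrMatrix h₁ h₂⟩
  have hX' := hlaw.comp hX
  have hY' := hlaw.comp hY
  have hprob := hX'.isProbabilityMeasure_iff.1 inferInstance
  exact HasLaw.fun_comp (Y := fun q : (ℝ × ℝ) × (ℝ × ℝ) => (q.1.1 / q.2.1, q.1.2 / q.2.2))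
    ⟨by fun_prop, map_ratio_prod_densityMeasure (measurable_gaussianDensity ρ)
      (measurable_tsum_mixComponent h₁ h₂) (lintegral_gaussianDensity_ratio h₁ h₂)⟩
    ((hXY.comp hc hc).hasLaw_prod hX' hY')

lemma hasSum_mixture_weights {ρ : ℝ} (h₁ : -1 < ρ) (h₂ : ρ < 1) :
    HasSum (fun n : ℕ => (1 - ρ ^ 2) * ρ ^ (2 * n)) 1 := by
  have hs := one_sub_sq_pos h₁ h₂
  have h := (hasSum_geometric_of_lt_one (sq_nonneg ρ) (by linarith)).mul_left (1 - ρ ^ 2)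
  rw [mul_inv_cancel₀ hs.ne'] at h
  simpa only [pow_mul] using h

theorem lemma2 :
    -- the joint density of the two ratios is the mixture of the components
    (∀ {Ω : Type*} [MeasurableSpace Ω] (P : Measure Ω) [IsProbabilityMeasure P]
        (ρ : ℝ), -1 < ρ → ρ < 1 →
        ∀ X Y : Ω → EuclideanSpace ℝ (Fin 2),
          HasLaw X (multivariateGaussian 0 (corrMatrix ρ)) P →
          HasLaw Y (multivariateGaussian 0 (corrMatrix ρ)) P →
          IndepFun X Y P →
          HasSum (fun n : ℕ => (1 - ρ ^ 2) * ρ ^ (2 * n)) 1 ∧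
          (∀ z : ℝ × ℝ, Summable (fun n : ℕ => ρ ^ (2 * n) * mixComponent n z)) ∧
          HasLaw (fun ω => (X ω 0 / Y ω 0, X ω 1 / Y ω 1))
            (densityMeasure
              (fun z => (1 - ρ ^ 2) * ∑' n : ℕ, ρ ^ (2 * n) * mixComponent n z)) P) ∧
    -- every component is a bivariate density with the asserted Cauchy properties
    (∀ n : ℕ,
        (∀ z : ℝ × ℝ, 0 ≤ mixComponent n z) ∧
        Integrable (mixComponent n) ∧
        ∫ z, mixComponent n z = 1 ∧
        ∀ {Ω : Type*} [MeasurableSpace Ω] (P : Measure Ω) [IsProbabilityMeasure P]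
          (C₁ C₂ : Ω → ℝ),
          HasLaw (fun ω => (C₁ ω, C₂ ω)) (densityMeasure (mixComponent n)) P →
          HasLaw C₁ (cauchyMeasure 0 1) P ∧
          HasLaw C₂ (cauchyMeasure 0 1) P ∧
          ∀ w₁ w₂ : ℝ, 0 ≤ w₁ → 0 ≤ w₂ → w₁ + w₂ = 1 →
            HasLaw (fun ω => w₁ * C₁ ω + w₂ * C₂ ω) (cauchyMeasure 0 1) P) := by
  refine ⟨fun {Ω} _ P _ ρ h₁ h₂ X Y hX hY hXY => ⟨hasSum_mixture_weights h₁ h₂,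
    summable_pow_mul_mixComponent h₁ h₂, hasLaw_ratio h₁ h₂ hX hY hXY⟩,
    fun n => ⟨mixComponent_nonneg n, integrable_mixComponent n, integral_mixComponent n,
      fun {Ω} _ P _ C₁ C₂ hC => ⟨?_, ?_, fun w₁ w₂ hw₁ hw₂ hw =>
        hasLaw_convexCombination hC hw₁ hw₂ hw⟩⟩⟩
  -- The marginals are the convex combinations with weights `(1, 0)` and `(0, 1)`.
  · simpa using hasLaw_convexCombination hC zero_le_one le_rfl (add_zero 1)
  · simpa using hasLaw_convexCombination hC le_rfl zero_le_one (zero_add 1)
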